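/- Let $a<b$ be real numbers, let $k\ge 1$ be an integer, and let $f:[a,b]\to\mathbb R$ be such that $f,f',\dots,f^{(k-1)}$ are absolutely continuous on $[a,b]$. Put $G(t)=a+\frac{b-a}{2}(t+1)$ for $t\in[-1,1]$ and $$V_k:=\int_0^\pi \bigl|f^{(k+1)}(G(\cos\theta))\bigr|\,d\theta ,$$ where $f^{(k+1)}$ is the distributional derivative on $(a,b)$ of the (almost everywhere defined) function $f^{(k)}$. Explicitly, by the substitution $x=G(\cos\theta)$, if this distributional derivative is a finite signed measure $\mu$ on $(a,b)$ with total variation measure $|\mu|$, then $$V_k=\int_{(a,b)}\frac{d|\mu|(x)}{\sqrt{(x-a)(b-x)}},$$ and $V_k=\infty$ otherwise. Assume $V_k<\infty$. Let $T_j(\cos\theta)=\cos j\theta$ be the Chebyshev polynomials of the first kind. For a positive integer $n$ let $t_l=\cos\frac{(2l-1)\pi}{2n}$, $l=1,\dots,n$, and $$c_{j,n}=\frac2n\sum_{l=1}^n f(G(t_l))\,T_j(t_l),\qquad C_{d,n}[f](x)=\frac{c_{0,n}}2+\sum_{j=1}^{d}c_{j,n}\,T_j(G^{-1}(x)),\quad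 x\in[a,b].$$ Let $n,d$ be integers with $n-1\ge k$ and $k\le d\le 2n-k-1$. Then $$\|f-C_{d,n}[f]\|_1=\int_a^b|f(x)-C_{d,n}[f](x)|\,dx\le \mathbb T_{d,n},$$ where $\mathbb T_{d,n}$ is defined as follows. Write $k=2s$ or $k=2s+1$ with an integer $s\ge0$, and put $$\Pi_{\alpha,\beta}(\eta)=\frac1{\prod_{i=-s}^{s-\alpha}(\eta+2i+\beta)}.$$ (1) If $d=n-l$ with $1\le l\le n-k$, then $$\mathbb T_{d,n}=\begin{cases}\left(\frac{b-a}2\right)^{k+2}\frac{4V_k}{k\pi}\bigl(\Pi_{1,1}(n-l)+\Pi_{1,2}(n-l)\bigr)&\text{if }k=2s,\\[1ex] \left(\frac{b-a}2\right)^{k+2}\frac{4V_k}{k\pi}\bigl(\Pi_{0,0}(n-l)+\Pi_{0,1}(n-l)\bigr)&\text{if }k=2s+1.\end{cases}$$ (2) If $d=n+l$ with $0\le l\le n-k-1$, then $$\mathbb T_{d,n}=\begin{cases}\left(\frac{b-a}2\right)^{k+2}\frac{6V_k}{k\pi}\bigl(\Pi_{1,0}(n-l)+\Pi_{1,1}(n-l)\bigr)&\text{if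 }k=2s,\\[1ex] \left(\frac{b-a}2\right)^{k+2}\frac{6V_k}{k\pi}\bigl(\Pi_{0,-1}(n-l)+\Pi_{0,0}(n-l)\bigr)&\text{if }k=2s+1.\end{cases}$$ -/

import Mathlib

open MeasureTheory Set
open scoped ENNReal ContDiff

noncomputable section

/-- The affine bijection `G : [-1,1] → [a,b]`, `G t = a + (b - a) / 2 * (t + 1)`. -/
def chebMap (a b t : ℝ) : ℝ := a + (b - a) / 2 * (t + 1)

/-- The inverse of `chebMap a b`, mapping `[a,b]` to `[-1,1]`. -/
def chebMapInv (a b x : ℝ) : ℝ := 2 * (x - a) / (b - a) - 1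

theorem chebMapInv_chebMap {a b : ℝ} (hab : a < b) (t : ℝ) :
    chebMapInv a b (chebMap a b t) = t := by
  have h : b - a ≠ 0 := (sub_pos.2 hab).ne'
  unfold chebMapInv chebMap
  field_simp
  ring

theorem chebMap_chebMapInv {a b : ℝ} (hab : a < b) (x : ℝ) :
    chebMap a b (chebMapInv a b x) = x := by
  have h : b - a ≠ 0 := (sub_pos.2 hab).ne'
  unfold chebMapInv chebMap
  field_simp
  ring

/-- The value at `t` of the Chebyshev polynomial of the first kind of degree `j`. -/
def chebT (j : ℕ) (t : ℝ) : ℝ := (Polynomial.Chebyshev.T ℝ (j : ℤ)).eval t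

/-- The Chebyshev points `t_l = cos ((2 l - 1) π / (2 n))`, `l = 1, …, n`. -/
def chebPoint (n l : ℕ) : ℝ := Real.cos ((2 * (l : ℝ) - 1) * Real.pi / (2 * (n : ℝ)))

/-- The approximate Chebyshev coefficient
`c_{j,n} = (2 / n) ∑_{l=1}^{n} f (G (t_l)) T_j (t_l)` of `f : [a,b] → ℝ`. -/
def approxCoeff (a b : ℝ) (f : ℝ → ℝ) (j n : ℕ) : ℝ :=
  2 / (n : ℝ) * ∑ l ∈ Finset.Icc 1 n, f (chebMap a b (chebPoint n l)) * chebT j (chebPoint n l)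

/-- `C_{d,n}[f](x) = ∑'_{j=0}^{d} c_{j,n} T_j (G⁻¹ x)`; the prime means that the term `j = 0`
is halved. -/
def chebApprox (a b : ℝ) (f : ℝ → ℝ) (d n : ℕ) (x : ℝ) : ℝ :=
  approxCoeff a b f 0 n * chebT 0 (chebMapInv a b x) / 2 +
    ∑ j ∈ Finset.Icc 1 d, approxCoeff a b f j n * chebT j (chebMapInv a b x)

/-- The signed measure `μ`, restricted to the open interval `(a,b)`, is the distributional
derivative on `(a,b)` of the locally integrable function `g`:
`∫ g φ' dx = - ∫ φ dμ` for all test functions `φ ∈ C_c^∞ (a,b)`. -/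
def IsDistribDeriv (a b : ℝ) (g : ℝ → ℝ) (μ : SignedMeasure ℝ) : Prop :=
  LocallyIntegrableOn g (Ioo a b) ∧
    ∀ φ : ℝ → ℝ, ContDiff ℝ ∞ φ → HasCompactSupport φ → tsupport φ ⊆ Ioo a b →
      ∫ x in Ioo a b, g x * deriv φ x =
        -((∫ x, φ x ∂μ.toJordanDecomposition.posPart) -
          ∫ x, φ x ∂μ.toJordanDecomposition.negPart)

/-- The weight `1 / √((x - a) (b - x))` that the measure `dθ` on `(0,π)` acquires under the
substitution `x = G (cos θ)`; see `lintegral_chebMap_cos`. -/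
def chebWeight (a b x : ℝ) : ℝ≥0∞ := ENNReal.ofReal (1 / √((x - a) * (b - x)))

/-- The substitution `x = G (cos θ)`. -/
theorem lintegral_chebMap_cos {a b : ℝ} (hab : a < b) (h : ℝ → ℝ≥0∞) :
    ∫⁻ θ in Ioo 0 Real.pi, h (chebMap a b (Real.cos θ)) =
      ∫⁻ x in Ioo a b, chebWeight a b x * h x := by
  have hba : 0 < b - a := sub_pos.2 hab
  have himg : (fun θ => chebMap a b (Real.cos θ)) '' Ioo 0 Real.pi = Ioo a b := by
    ext x
    constructor
    · rintro ⟨θ, ⟨h0, h1⟩, rfl⟩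
      have hs := Real.sin_pos_of_pos_of_lt_pi h0 h1
      have hc := Real.sin_sq_add_cos_sq θ
      have c1 : Real.cos θ < 1 := by nlinarith
      have c2 : -1 < Real.cos θ := by nlinarith
      simp only [chebMap, mem_Ioo]
      constructor <;> nlinarith
    · rintro ⟨h0, h1⟩
      have e1 : -1 < chebMapInv a b x := by
        have : 0 < 2 * (x - a) / (b - a) := by
          apply div_pos _ hba; linarith
        unfold chebMapInv; linarith
      have e2 : chebMapInv a b x < 1 := by
        have : 2 * (x - a) / (b - a) < 2 := by
          rw [div_lt_iff₀ hba]; linarith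
        unfold chebMapInv; linarith
      refine ⟨Real.arccos (chebMapInv a b x),
        ⟨Real.arccos_pos.2 e2, Real.arccos_lt_pi.2 e1⟩, ?_⟩
      simp only
      rw [Real.cos_arccos e1.le e2.le, chebMap_chebMapInv hab]
  have hder : ∀ θ ∈ Ioo (0 : ℝ) Real.pi,
      HasDerivWithinAt (fun θ => chebMap a b (Real.cos θ))
        (-((b - a) / 2 * Real.sin θ)) (Ioo 0 Real.pi) θ := by
    intro θ _
    have := (((Real.hasDerivAt_cos θ).add_const 1).const_mul ((b - a) / 2)).const_add a
    exact (this.congr_deriv (by ring)).hasDerivWithinAt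
  have hinj : InjOn (fun θ => chebMap a b (Real.cos θ)) (Ioo 0 Real.pi) := by
    intro x hx y hy hxy
    have := congrArg (chebMapInv a b) hxy
    simp only [chebMapInv_chebMap hab] at this
    exact Real.injOn_cos (Ioo_subset_Icc_self hx) (Ioo_subset_Icc_self hy) this
  rw [← himg, lintegral_image_eq_lintegral_abs_deriv_mul measurableSet_Ioo hder hinj]
  refine setLIntegral_congr_fun measurableSet_Ioo fun θ hθ => ?_
  have hs := Real.sin_pos_of_pos_of_lt_pi hθ.1 hθ.2
  have hw : (chebMap a b (Real.cos θ) - a) * (b - chebMap a b (Real.cos θ)) =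
      ((b - a) / 2 * Real.sin θ) ^ 2 := by
    have := Real.sin_sq_add_cos_sq θ
    simp only [chebMap]
    linear_combination (-(b - a) ^ 2 / 4) * this
  have hp : 0 < (b - a) / 2 * Real.sin θ := by positivity
  simp only [chebWeight]
  rw [hw, Real.sqrt_sq hp.le, abs_neg, abs_of_pos hp, ← mul_assoc,
    ← ENNReal.ofReal_mul hp.le, mul_one_div_cancel hp.ne', ENNReal.ofReal_one, one_mul]

/-- The quantity `‖g‖_T = ∫_0^π |g' (G (cos θ))| dθ ∈ [0,∞]`, where `g'` is the distributional
derivative of `g` on `(a,b)`. After the substitution `x = G (cos θ)` it reads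
`∫_(a,b) 1 / √((x - a) (b - x)) d|g'|(x)`, which makes sense when `g'` is a signed measure with
total variation measure `|g'|`. If the distributional derivative is not a finite signed measure,
the value is `∞`. The infimum has only one value to range over, because the restriction of `g'`
to `(a,b)` is unique. -/
def chebNorm (a b : ℝ) (g : ℝ → ℝ) : ℝ≥0∞ :=
  ⨅ (μ : SignedMeasure ℝ) (_ : IsDistribDeriv a b g μ),
    ∫⁻ x in Ioo a b, chebWeight a b x ∂μ.totalVariation

/-- The reciprocal product `Π_{α,β}(η) = 1 / ∏_{i=-s}^{s-α} (η + 2 i + β)`. -/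
def recipProd (s : ℕ) (α β : ℤ) (η : ℝ) : ℝ :=
  1 / ∏ i ∈ Finset.Icc (-(s : ℤ)) ((s : ℤ) - α), (η + 2 * (i : ℝ) + (β : ℝ))

/-- The error bound `T_{d,n}`, where `V` stands for `V_k`, and `s = ⌊k / 2⌋`, that is, `k = 2 s`
or `k = 2 s + 1`. The first branch is the case `d = n - l` with `l ≥ 1`, the second one the case
`d = n + l` with `l ≥ 0`. -/
def errorBound (a b V : ℝ) (k n d : ℕ) : ℝ :=
  let s : ℕ := k / 2
  if d < n then
    let l : ℕ := n - d
    let η : ℝ := (n : ℝ) - (l : ℝ)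
    if Even k then
      ((b - a) / 2) ^ (k + 2) * (4 * V / (k * Real.pi)) * (recipProd s 1 1 η + recipProd s 1 2 η)
    else
      ((b - a) / 2) ^ (k + 2) * (4 * V / (k * Real.pi)) * (recipProd s 0 0 η + recipProd s 0 1 η)
  else
    let l : ℕ := d - n
    let η : ℝ := (n : ℝ) - (l : ℝ)
    if Even k then
      ((b - a) / 2) ^ (k + 2) * (6 * V / (k * Real.pi)) * (recipProd s 1 0 η + recipProd s 1 1 η)
    else
      ((b - a) / 2) ^ (k + 2) * (6 * V / (k * Real.pi)) *
        (recipProd s 0 (-1) η + recipProd s 0 0 η)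

end

/-!
Let `E` be the operator that sends a function on `[-1,1]` to its remainder `chebRemainder`. It is
linear and involves finitely many values of the function. The bound holds because `E` is small on
each of the functions from which `f ∘ G` is built.

* *Chebyshev polynomials.* By discrete orthogonality at the Chebyshev points, the approximation
  maps `T_i` to a combination, with coefficients `±1`, of the `T_j` with `|j| ≤ d` and
  `2 n ∣ i + j`, where `T_{-j} = T_j`. With `M = min d (2 n - d - 1)` this gives `E T_i = 0` for
  `|i| ≤ M` (`chebRemainder_T_eq_zero`) and `|E T_i| ≤ r + 1` for all `i`, where `r` bounds the
  number of such `j`: `r = 1` if `d < n` and `r = 2` if `n ≤ d < 2 n` (`abs_chebRemainder_T_le`).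
  This `r` is the source of the constants `4` and `6`, which are `2 (r + 1)`, in the two cases.
* *Truncated powers.* Let `u ∈ [-1,1]` and let `a_j` be the Chebyshev coefficients of
  `(x - u)₊ ^ k / k!`. Integration by parts expresses `a_j` by the coefficients with indices `j - 1`
  and `j + 1` for exponent `k - 1`, and induction gives
  `|a_j| ≤ (2 / π) / ((j - k) (j - k + 2) ⋯ (j + k))` for `j > k`
  (`abs_chebIntegral_truncPow_le`). The series converges to the function by Fourier theory, and the
  tail over `j > M` telescopes (`sum_stepProd_le`), so that `E` of the truncated power is bounded
  uniformly (`abs_chebRemainder_truncPow_le`).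
* *The function `f`.* If the signed measure `μ` is the distributional derivative of `f^(k)`, then
  the lemma of du Bois-Reymond and `k` integrations write `f` on `[a,b]` as a polynomial of degree at
  most `k` plus `∫_(a,b) (x - u)₊ ^ k / k! dμ(u)`
  (`eq_polynomial_add_truncPot_of_isDistribDeriv`). The operator `E` kills the polynomial and passes
  under the integral, which bounds `|f - C_{d,n}[f]|` uniformly by a multiple of `|μ| (a,b)`.

Finally `|μ| (a,b) ≤ (b - a) / 2 * ∫ 1 / √((x - a) (b - x)) d|μ|`, since the geometric mean of
`x - a` and `b - x` is at most `(b - a) / 2`, and the `L¹` norm is at most `b - a` times the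
supremum.
-/

noncomputable section

/-! ### The approximation operator and aliasing -/

open Polynomial.Chebyshev in
theorem chebT_cos (j : ℕ) (τ : ℝ) : chebT j (Real.cos τ) = Real.cos (j * τ) := by
  simp [chebT, T_real_cos]

/-- The angle `(2 l - 1) π / (2 n)` of the Chebyshev point `t_l`. -/
def chebAngle (n l : ℕ) : ℝ := (2 * (l : ℝ) - 1) * Real.pi / (2 * (n : ℝ))

theorem chebPoint_eq_cos (n l : ℕ) : chebPoint n l = Real.cos (chebAngle n l) := rfl

/-- The weight with which the sample of a function at `t_l` enters its Chebyshev approximation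
at `t`. -/
def chebKernel (n d l : ℕ) (t : ℝ) : ℝ :=
  2 / (n : ℝ) * (1 / 2 + ∑ j ∈ Finset.Icc 1 d, chebT j (chebPoint n l) * chebT j t)

theorem chebApprox_eq_sum_chebKernel (a b : ℝ) (f : ℝ → ℝ) (d n : ℕ) (x : ℝ) :
    chebApprox a b f d n x = ∑ l ∈ Finset.Icc 1 n,
      f (chebMap a b (chebPoint n l)) * chebKernel n d l (chebMapInv a b x) := by
  have h0 : ∀ t, chebT 0 t = 1 := fun t => by simp [chebT]
  simp only [chebApprox, approxCoeff, chebKernel, h0, mul_one, mul_add, Finset.sum_add_distrib,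
    Finset.mul_sum, Finset.sum_mul, Finset.sum_div]
  rw [Finset.sum_comm (s := Finset.Icc 1 d)]
  congr 1
  · exact Finset.sum_congr rfl fun _ _ => by ring
  · exact Finset.sum_congr rfl fun _ _ => Finset.sum_congr rfl fun _ _ => by ring

/-- The remainder at `t` of the approximation on `[-1,1]` that samples `φ` at `n` Chebyshev points
and keeps the terms of degree at most `d`. -/
def chebRemainder (n d : ℕ) (φ : ℝ → ℝ) (t : ℝ) : ℝ :=
  φ t - ∑ l ∈ Finset.Icc 1 n, φ (chebPoint n l) * chebKernel n d l t

/-- The mean of `cos (m θ)` over the angles of the `n` Chebyshev points. It is `1` for `m = 0` and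
vanishes unless `2 n ∣ m`. -/
def nodeMean (n : ℕ) (m : ℤ) : ℝ :=
  1 / (n : ℝ) * ∑ l ∈ Finset.Icc 1 n, Real.cos (m * chebAngle n l)

theorem abs_nodeMean_le_one (n : ℕ) (m : ℤ) : |nodeMean n m| ≤ 1 := by
  rcases Nat.eq_zero_or_pos n with rfl | hn
  · simp [nodeMean]
  have hn' : (0 : ℝ) < n := by exact_mod_cast hn
  rw [nodeMean, abs_mul, abs_of_pos (by positivity), one_div, inv_mul_le_iff₀ hn', mul_one]
  refine (Finset.abs_sum_le_sum_abs _ _).trans ?_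
  refine (Finset.sum_le_sum fun l _ => Real.abs_cos_le_one _).trans ?_
  simp

theorem nodeMean_zero {n : ℕ} (hn : n ≠ 0) : nodeMean n 0 = 1 := by
  have : (n : ℝ) ≠ 0 := by exact_mod_cast hn
  simp [nodeMean, this]

open Polynomial.Chebyshev in
theorem nodeMean_of_not_dvd {n : ℕ} {m : ℤ} (hm : ¬ (2 * n : ℤ) ∣ m) : nodeMean n m = 0 := by
  have h := sumZeroes_T_of_not_dvd hm
  rcases Nat.eq_zero_or_pos n with rfl | hn
  · simp [nodeMean]
  have hn' : (0 : ℝ) < n := by exact_mod_cast hn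
  rw [sumZeroes, mul_eq_zero_iff_left (by positivity)] at h
  simp only [T_real_cos] at h
  rw [nodeMean, ← Finset.Ico_add_one_right_eq_Icc, Finset.sum_Ico_eq_sum_range]
  refine mul_eq_zero_of_right _ (Eq.trans ?_ h)
  refine Finset.sum_congr rfl fun l _ => ?_
  rw [chebAngle]
  push_cast
  ring_nf

theorem nodeMean_mul (n : ℕ) (i j : ℤ) :
    1 / (n : ℝ) * ∑ l ∈ Finset.Icc 1 n, Real.cos (i * chebAngle n l) * Real.cos (j * chebAngle n l)
      = (nodeMean n (i + j) + nodeMean n (i - j)) / 2 := by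
  simp only [nodeMean]
  rw [← mul_add, ← Finset.sum_add_distrib, mul_div_assoc, Finset.sum_div]
  congr 1
  refine Finset.sum_congr rfl fun l _ => ?_
  push_cast
  rw [add_mul, sub_mul, Real.cos_add, Real.cos_sub]
  ring

theorem Finset.sum_Icc_neg_of_even {g : ℤ → ℝ} (hg : ∀ j, g (-j) = g j) (d : ℕ) :
    ∑ j ∈ Finset.Icc (-(d : ℤ)) d, g j = g 0 + 2 * ∑ j ∈ Finset.Icc 1 d, g j := by
  induction d with
  | zero => simp
  | succ d ih =>
    have : Finset.Icc (-((d + 1 : ℕ) : ℤ)) (d + 1 : ℕ) =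
        insert (-((d + 1 : ℕ) : ℤ)) (insert ((d + 1 : ℕ) : ℤ) (Finset.Icc (-(d : ℤ)) d)) := by
      ext x; simp only [Finset.mem_Icc, Finset.mem_insert]; omega
    rw [this, Finset.sum_insert, Finset.sum_insert, ih, Finset.sum_Icc_succ_top (by omega), hg]
    · ring
    · simp
    · simp only [Finset.mem_Icc, Finset.mem_insert]; omega

theorem chebKernel_cos (n d l : ℕ) (τ : ℝ) :
    chebKernel n d l (Real.cos τ) = 1 / (n : ℝ) * ∑ j ∈ Finset.Icc (-(d : ℤ)) d,
      Real.cos (j * chebAngle n l) * Real.cos (j * τ) := by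
  rw [Finset.sum_Icc_neg_of_even fun j => by simp]
  simp only [chebKernel, chebPoint_eq_cos, chebT_cos]
  simp
  ring

/-- Aliasing: the approximation replaces `T_i` by a combination of those `T_j` with `|j| ≤ d` for
which `2 n` divides `i + j`. -/
theorem chebRemainder_T (n d : ℕ) (i : ℤ) (τ : ℝ) :
    chebRemainder n d (fun t => (Polynomial.Chebyshev.T ℝ i).eval t) (Real.cos τ) =
      Real.cos (i * τ) -
        ∑ j ∈ Finset.Icc (-(d : ℤ)) d, nodeMean n (i + j) * Real.cos (j * τ) := by
  have hsymm : ∑ j ∈ Finset.Icc (-(d : ℤ)) d, nodeMean n (i - j) * Real.cos (j * τ) =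
      ∑ j ∈ Finset.Icc (-(d : ℤ)) d, nodeMean n (i + j) * Real.cos (j * τ) := by
    refine Finset.sum_nbij' (fun j => -j) (fun j => -j) ?_ ?_ ?_ ?_ ?_ <;>
      simp +contextual [sub_eq_add_neg, neg_le]
  rw [chebRemainder]
  simp only [chebPoint_eq_cos, Polynomial.Chebyshev.T_real_cos, chebKernel_cos]
  congr 1
  calc _ = ∑ j ∈ Finset.Icc (-(d : ℤ)) d, (1 / (n : ℝ) * ∑ l ∈ Finset.Icc 1 n,
        Real.cos (i * chebAngle n l) * Real.cos (j * chebAngle n l)) * Real.cos (j * τ) := by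
        simp only [Finset.mul_sum, Finset.sum_mul]
        rw [Finset.sum_comm]
        exact Finset.sum_congr rfl fun _ _ => Finset.sum_congr rfl fun _ _ => by ring
    _ = (∑ j ∈ Finset.Icc (-(d : ℤ)) d, nodeMean n (i + j) * Real.cos (j * τ) +
        ∑ j ∈ Finset.Icc (-(d : ℤ)) d, nodeMean n (i - j) * Real.cos (j * τ)) / 2 := by
        rw [← Finset.sum_add_distrib, Finset.sum_div]
        refine Finset.sum_congr rfl fun j _ => ?_
        rw [nodeMean_mul]; ring
    _ = _ := by rw [hsymm]; ring

/-- The approximation reproduces `T_i` for `|i| ≤ d` as long as no other index `j` with `|j| ≤ d`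
is congruent to `i` modulo `2 n`. -/
theorem chebRemainder_T_eq_zero {n d : ℕ} (hn : n ≠ 0) {i : ℤ} (h1 : |i| ≤ d)
    (h2 : |i| + d < 2 * n) (τ : ℝ) :
    chebRemainder n d (fun t => (Polynomial.Chebyshev.T ℝ i).eval t) (Real.cos τ) = 0 := by
  rw [chebRemainder_T, Finset.sum_eq_single (-i)]
  · simp [nodeMean_zero hn]
  · intro j hj hji
    rw [nodeMean_of_not_dvd, zero_mul]
    intro hdvd
    have := Int.eq_zero_of_abs_lt_dvd hdvd
      (by rw [Finset.mem_Icc] at hj; rw [abs_lt]; rw [abs_le] at h1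
          constructor <;> cases abs_cases i <;> omega)
    omega
  · intro h
    exact absurd (Finset.mem_Icc.2 (by rw [abs_le] at h1; omega)) h

/-- The remainder of `T_i` has absolute value at most `r + 1`, if every interval of `2 d + 1`
consecutive integers has at most `r` multiples of `2 n`. -/
theorem abs_chebRemainder_T_le {n d r : ℕ} (hd : 2 * d + 1 ≤ r * (2 * n)) (i : ℤ) (τ : ℝ) :
    |chebRemainder n d (fun t => (Polynomial.Chebyshev.T ℝ i).eval t) (Real.cos τ)| ≤ r + 1 := by
  have hn : 0 < n := by
    rcases Nat.eq_zero_or_pos n with rfl | hn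
    · simp at hd
    · exact hn
  rw [chebRemainder_T, add_comm]
  refine (abs_sub _ _).trans (add_le_add (Real.abs_cos_le_one _) ?_)
  calc _ ≤ ∑ j ∈ Finset.Icc (-(d : ℤ)) d, if (2 * n : ℤ) ∣ i + j then (1 : ℝ) else 0 := by
        refine (Finset.abs_sum_le_sum_abs _ _).trans (Finset.sum_le_sum fun j _ => ?_)
        split_ifs with h
        · rw [abs_mul]
          exact mul_le_one₀ (abs_nodeMean_le_one _ _) (abs_nonneg _) (Real.abs_cos_le_one _)
        · simp [nodeMean_of_not_dvd h]
    _ = ((Finset.Icc (-(d : ℤ)) d).filter fun j => (2 * n : ℤ) ∣ i + j).card := by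
        rw [Finset.sum_boole]
    _ ≤ r := ?_
  norm_cast
  have hpos : (0 : ℤ) < 2 * n := by omega
  -- the multiples `2 n q` met have quotients `q` in an interval of length `< r`
  have hsub : ((Finset.Icc (-(d : ℤ)) d).filter fun j => (2 * n : ℤ) ∣ i + j).card ≤
      (Finset.Ico ((i + d) / (2 * n) + 1 - r) ((i + d) / (2 * n) + 1)).card := by
    refine Finset.card_le_card_of_injOn (fun j => (i + j) / (2 * n)) ?_ ?_
    · intro j hj
      simp only [Finset.mem_coe, Finset.mem_filter, Finset.mem_Icc] at hj
      obtain ⟨⟨h1, h2⟩, q, hq⟩ := hj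
      have e : (i + j) / (2 * n) = q := by rw [hq]; exact Int.mul_ediv_cancel_left _ hpos.ne'
      simp only [Finset.coe_Ico, mem_Ico, e]
      have hq1 : q ≤ (i + d) / (2 * n) := by rw [Int.le_ediv_iff_mul_le hpos]; linarith
      have hq2 : (i + d) / (2 * n) < q + r := by
        rw [Int.ediv_lt_iff_lt_mul hpos]
        have : (2 * (d : ℤ) + 1) ≤ r * (2 * n) := by exact_mod_cast hd
        nlinarith
      omega
    · intro j hj j' hj' h
      simp only [Finset.mem_coe, Finset.mem_filter, Finset.mem_Icc] at hj hj'
      have h1 := Int.ediv_mul_cancel hj.2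
      have h2 := Int.ediv_mul_cancel hj'.2
      simp only at h
      rw [h] at h1
      omega
  refine hsub.trans ?_
  simp

/-- `T_0, …, T_k` span the polynomials of degree at most `k`, so this follows from
`chebRemainder_T_eq_zero`. -/
theorem chebRemainder_polynomial_eq_zero {n d k : ℕ} (hn : n ≠ 0) (hkd : k ≤ d)
    (hkn : k + d < 2 * n) {p : Polynomial ℝ} (hp : p.natDegree ≤ k) (τ : ℝ) :
    chebRemainder n d (fun t => p.eval t) (Real.cos τ) = 0 := by
  let S : Polynomial.Sequence ℝ :=
    ⟨fun i => Polynomial.Chebyshev.T ℝ i, fun i => by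
      rw [Polynomial.Chebyshev.degree_T]; simp⟩
  have hspan := S.span_degreeLE (m := k) fun i _ =>
    (Polynomial.leadingCoeff_ne_zero.2 (S.ne_zero i)).isUnit
  have hmem : p ∈ Polynomial.degreeLE ℝ k :=
    Polynomial.mem_degreeLE.2 (Polynomial.natDegree_le_iff_degree_le.1 hp)
  rw [← hspan] at hmem
  clear hp
  induction hmem using Submodule.span_induction with
  | mem q hq =>
    obtain ⟨i, hi, rfl⟩ := hq
    have hi' : i ≤ k := hi
    exact chebRemainder_T_eq_zero hn (i := (i : ℤ)) (by simp; omega) (by simp; omega) τ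
  | zero => simp [chebRemainder]
  | add q r _ _ hq hr =>
    have : ∀ t, (q + r).eval t = q.eval t + r.eval t := fun t => Polynomial.eval_add
    simp only [chebRemainder, this, add_mul, Finset.sum_add_distrib] at hq hr ⊢
    linarith
  | smul c q _ hq =>
    have : ∀ t, (c • q).eval t = c * q.eval t := fun t => by simp
    simp only [chebRemainder, this, mul_assoc, ← Finset.mul_sum] at hq ⊢
    rw [← mul_sub, hq, mul_zero]

/-! ### Chebyshev coefficients of truncated powers -/

open scoped Nat in
/-- The truncated power `x ↦ (x - u)₊ ^ m / m!`. For `m = 0` it is the indicator function of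
`(u,∞)`. -/
def truncPow (m : ℕ) (u x : ℝ) : ℝ := if u < x then (x - u) ^ m / m ! else 0

theorem measurable_truncPow (m : ℕ) : Measurable fun p : ℝ × ℝ => truncPow m p.1 p.2 := by
  unfold truncPow
  exact Measurable.ite (measurableSet_lt measurable_fst measurable_snd) (by fun_prop)
    measurable_const

theorem truncPow_nonneg (m : ℕ) (u x : ℝ) : 0 ≤ truncPow m u x := by
  unfold truncPow
  split_ifs with h
  · have := (sub_pos.2 h).le
    positivity
  · exact le_rfl

theorem truncPow_le {m : ℕ} {u x c : ℝ} (hc : 0 ≤ c) (h : x - u ≤ c) : truncPow m u x ≤ c ^ m := by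
  unfold truncPow
  split_ifs with hu
  · have h0 := (sub_pos.2 hu).le
    exact (div_le_self (by positivity) (by exact_mod_cast m.factorial_pos)).trans
      (pow_le_pow_left₀ h0 h m)
  · positivity

theorem hasDerivAt_truncPow_succ {m : ℕ} {u x : ℝ} (h : x ≠ u) :
    HasDerivAt (truncPow (m + 1) u) (truncPow m u x) x := by
  rcases lt_or_gt_of_ne h with h | h
  · have : truncPow (m + 1) u =ᶠ[nhds x] fun _ => 0 := by
      filter_upwards [gt_mem_nhds h] with y hy
      simp [truncPow, hy.le]
    rw [truncPow, if_neg h.le.not_gt]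
    exact (hasDerivAt_const x (0 : ℝ)).congr_of_eventuallyEq this
  · have : truncPow (m + 1) u =ᶠ[nhds x] fun y => (y - u) ^ (m + 1) / (m + 1).factorial := by
      filter_upwards [lt_mem_nhds h] with y hy
      simp [truncPow, hy]
    rw [truncPow, if_pos h]
    refine HasDerivAt.congr_of_eventuallyEq ?_ this
    refine ((((hasDerivAt_id x).sub_const u).pow (m + 1)).div_const _).congr_deriv ?_
    have : ((m : ℝ) + 1) ≠ 0 := by positivity
    simp only [Nat.factorial_succ, id]
    push_cast
    simp
    field_simp

theorem continuous_truncPow_succ (m : ℕ) (u : ℝ) : Continuous (truncPow (m + 1) u) := by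
  have : truncPow (m + 1) u = fun x => (max (x - u) 0) ^ (m + 1) / (m + 1).factorial := by
    ext x
    unfold truncPow
    split_ifs with h
    · rw [max_eq_left (sub_pos.2 h).le]
    · rw [max_eq_right (by linarith)]; simp
  rw [this]
  fun_prop

/-- The integral `∫_0^π φ (cos θ) cos (j θ) dθ`, which is `π / 2` times the `j`-th Chebyshev
coefficient of `φ`. -/
def chebIntegral (φ : ℝ → ℝ) (j : ℤ) : ℝ :=
  ∫ θ in (0 : ℝ)..Real.pi, φ (Real.cos θ) * Real.cos (j * θ)

theorem chebIntegral_neg (φ : ℝ → ℝ) (j : ℤ) : chebIntegral φ (-j) = chebIntegral φ j := by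
  simp [chebIntegral]

theorem intervalIntegrable_truncPow_cos_mul (m : ℕ) (u : ℝ) {g : ℝ → ℝ} (hg : Continuous g)
    (x y : ℝ) :
    IntervalIntegrable (fun θ => truncPow m u (Real.cos θ) * g θ) volume x y := by
  refine IntervalIntegrable.mul_continuousOn ?_ hg.continuousOn
  have hm : Measurable fun θ => truncPow m u (Real.cos θ) :=
    (measurable_truncPow m).comp (measurable_const.prodMk Real.measurable_cos)
  refine (intervalIntegrable_const (c := (1 + |u|) ^ m)).mono_fun hm.aestronglyMeasurable ?_
  refine Filter.Eventually.of_forall fun θ => ?_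
  dsimp only
  rw [Real.norm_of_nonneg (truncPow_nonneg _ _ _), Real.norm_of_nonneg (by positivity)]
  refine truncPow_le (by positivity) ?_
  linarith [Real.cos_le_one θ, neg_abs_le u]

/-- Integration by parts. The endpoint terms vanish because `sin (j θ)` does. -/
theorem chebIntegral_truncPow_succ (m : ℕ) (u : ℝ) {j : ℤ} (hj : j ≠ 0) :
    chebIntegral (truncPow (m + 1) u) j =
      (chebIntegral (truncPow m u) (j - 1) - chebIntegral (truncPow m u) (j + 1)) / (2 * j) := by
  have hj' : (j : ℝ) ≠ 0 := by exact_mod_cast hj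
  have hi := fun i : ℤ => intervalIntegrable_truncPow_cos_mul m u
    (g := fun θ => Real.cos (i * θ)) (by fun_prop) 0 Real.pi
  have hi' := intervalIntegrable_truncPow_cos_mul (m + 1) u
    (g := fun θ => Real.cos (j * θ)) (by fun_prop) 0 Real.pi
  have hsub := ((hi (j - 1)).sub (hi (j + 1))).div_const (2 * j)
  have key := integral_eq_of_hasDerivAt_off_countable_of_le
    (fun θ => truncPow (m + 1) u (Real.cos θ) * (Real.sin (j * θ) / j))
    (fun θ => truncPow (m + 1) u (Real.cos θ) * Real.cos (j * θ) -
      (truncPow m u (Real.cos θ) * Real.cos ((j - 1 : ℤ) * θ) -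
        truncPow m u (Real.cos θ) * Real.cos ((j + 1 : ℤ) * θ)) / (2 * j))
    Real.pi_pos.le (countable_singleton (Real.arccos u))
    (((continuous_truncPow_succ m u).comp Real.continuous_cos).mul
      (by fun_prop)).continuousOn
    (fun θ hθ => ?_) (hi'.sub hsub)
  · rw [intervalIntegral.integral_sub hi' hsub, intervalIntegral.integral_div,
      intervalIntegral.integral_sub (hi _) (hi _)] at key
    simp only [chebIntegral]
    rw [mul_zero, Real.sin_zero, Real.sin_int_mul_pi, zero_div, mul_zero, mul_zero] at key
    linarith
  · have hne : Real.cos θ ≠ u := fun h => hθ.2 <| by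
      rw [mem_singleton_iff, ← h, Real.arccos_cos hθ.1.1.le hθ.1.2.le]
    have h1 := (hasDerivAt_truncPow_succ (m := m) hne).comp θ (Real.hasDerivAt_cos θ)
    have h2 := ((((hasDerivAt_id θ).const_mul (j : ℝ)).sin).div_const (j : ℝ))
    refine (h1.mul h2).congr_deriv ?_
    push_cast
    simp only [sub_mul, add_mul, one_mul, Real.cos_sub, Real.cos_add, Function.comp, id]
    field_simp
    ring

/-- For the indicator function of `(u,∞)` the integral is `sin (j arccos u) / j`. -/
theorem abs_chebIntegral_truncPow_zero_le {u : ℝ} (hu : u ∈ Icc (-1 : ℝ) 1) {j : ℤ} (hj : 0 < j) :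
    |chebIntegral (truncPow 0 u) j| ≤ (j : ℝ)⁻¹ := by
  have hj' : (0 : ℝ) < j := by exact_mod_cast hj
  set ψ := Real.arccos u with hψ
  have h0 : 0 ≤ ψ := Real.arccos_nonneg u
  have h1 : ψ ≤ Real.pi := Real.arccos_le_pi u
  have hc : Real.cos ψ = u := Real.cos_arccos hu.1 hu.2
  have hi := intervalIntegrable_truncPow_cos_mul 0 u (g := fun θ => Real.cos (j * θ)) (by fun_prop)
  have e1 : ∫ θ in (0 : ℝ)..ψ, truncPow 0 u (Real.cos θ) * Real.cos (j * θ) =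
      ∫ θ in (0 : ℝ)..ψ, Real.cos (j * θ) := by
    refine intervalIntegral.integral_congr_Ioo_of_le h0 fun θ hθ => ?_
    have : u < Real.cos θ := by
      rw [← hc]; exact Real.cos_lt_cos_of_nonneg_of_le_pi hθ.1.le h1 hθ.2
    simp [truncPow, this]
  have e2 : ∫ θ in ψ..Real.pi, truncPow 0 u (Real.cos θ) * Real.cos (j * θ) =
      ∫ θ in ψ..Real.pi, 0 := by
    refine intervalIntegral.integral_congr_Ioo_of_le h1 fun θ hθ => ?_
    have : Real.cos θ ≤ u := by
      rw [← hc]; exact (Real.cos_lt_cos_of_nonneg_of_le_pi h0 hθ.2.le hθ.1).le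
    simp [truncPow, this]
  rw [chebIntegral, ← intervalIntegral.integral_add_adjacent_intervals (hi 0 ψ) (hi ψ Real.pi),
    e1, e2, intervalIntegral.integral_zero, add_zero,
    intervalIntegral.integral_comp_mul_left _ hj'.ne', integral_cos]
  simp only [mul_zero, Real.sin_zero, sub_zero, smul_eq_mul, abs_mul, abs_inv, abs_of_pos hj']
  exact mul_le_of_le_one_right (by positivity) (Real.abs_sin_le_one _)

/-- The reciprocal `1 / ((x - m) (x - m + 2) ⋯ (x + m))` of a product of `m + 1` factors. -/
def stepProd (m : ℕ) (x : ℝ) : ℝ := (∏ i ∈ Finset.range (m + 1), (x - m + 2 * i))⁻¹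

theorem stepProd_pos {m : ℕ} {x : ℝ} (hx : m < x) : 0 < stepProd m x :=
  inv_pos.2 <| Finset.prod_pos fun i _ => by
    have : (0 : ℝ) ≤ i := i.cast_nonneg
    linarith

theorem stepProd_sub_one (m : ℕ) {x : ℝ} (hx : m + 1 < x) :
    stepProd m (x - 1) = (x + m + 1) * stepProd (m + 1) x := by
  have h1 : (0 : ℝ) ≤ m := m.cast_nonneg
  have : ∏ i ∈ Finset.range (m + 1 + 1), (x - (m + 1 : ℕ) + 2 * i) =
      (∏ i ∈ Finset.range (m + 1), (x - 1 - m + 2 * (i : ℝ))) * (x + m + 1) := by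
    rw [Finset.prod_range_succ]
    congr 1
    · exact Finset.prod_congr rfl fun i _ => by push_cast; ring
    · push_cast; ring
  rw [stepProd, stepProd, this, mul_inv, mul_left_comm, mul_inv_cancel₀ (by linarith), mul_one]

theorem stepProd_add_one (m : ℕ) {x : ℝ} (hx : m + 1 < x) :
    stepProd m (x + 1) = (x - (m + 1)) * stepProd (m + 1) x := by
  have : ∏ i ∈ Finset.range (m + 1 + 1), (x - (m + 1 : ℕ) + 2 * i) =
      (∏ i ∈ Finset.range (m + 1), (x + 1 - m + 2 * (i : ℝ))) * (x - (m + 1)) := by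
    rw [Finset.prod_range_succ']
    congr 1
    · exact Finset.prod_congr rfl fun i _ => by push_cast; ring
    · push_cast; ring
  rw [stepProd, stepProd, this, mul_inv, mul_left_comm, mul_inv_cancel₀ (by linarith), mul_one]

/-- The bound is inherited through integration by parts because
`stepProd m (j - 1) + stepProd m (j + 1) = 2 j stepProd (m + 1) j`. -/
theorem abs_chebIntegral_truncPow_le {u : ℝ} (hu : u ∈ Icc (-1 : ℝ) 1) (m : ℕ) {j : ℤ}
    (hj : m < j) : |chebIntegral (truncPow m u) j| ≤ stepProd m j := by
  induction m generalizing j with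
  | zero => simpa [stepProd] using abs_chebIntegral_truncPow_zero_le hu (by simpa using hj)
  | succ m ih =>
    push_cast at hj
    have hj0 : (0 : ℝ) < j := by exact_mod_cast (by omega : (0 : ℤ) < j)
    have hj1 : (m : ℝ) + 1 < j := by exact_mod_cast hj
    rw [chebIntegral_truncPow_succ m u (by omega), abs_div,
      abs_of_pos (by positivity : 0 < 2 * (j : ℝ)), div_le_iff₀ (by positivity)]
    calc _ ≤ stepProd m ((j - 1 : ℤ) : ℝ) + stepProd m ((j + 1 : ℤ) : ℝ) :=
          (abs_sub _ _).trans (add_le_add (ih (by omega)) (ih (by omega)))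
      _ = stepProd (m + 1) j * (2 * j) := by
          push_cast
          rw [stepProd_sub_one m hj1, stepProd_add_one m hj1]
          ring

/-- The sum telescopes, because
`2 (m + 1) stepProd (m + 1) x = stepProd m (x - 1) - stepProd m (x + 1)`. -/
theorem sum_stepProd_le {m M : ℕ} (hM : m + 1 ≤ M) (N : ℕ) :
    ∑ i ∈ Finset.range N, stepProd (m + 1) (i + (M + 1) : ℕ) ≤
      (stepProd m M + stepProd m (M + 1)) / (2 * (m + 1)) := by
  have key : ∑ i ∈ Finset.range N, stepProd (m + 1) (i + (M + 1) : ℕ) =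
      (stepProd m M + stepProd m (M + 1) -
        (stepProd m (M + N) + stepProd m (M + N + 1))) / (2 * (m + 1)) := by
    induction N with
    | zero => simp
    | succ N ih =>
      have hx : (m : ℝ) + 1 < M + N + 1 := by exact_mod_cast (by omega : m + 1 < M + N + 1)
      have h1 := stepProd_sub_one m hx
      have h2 := stepProd_add_one m hx
      rw [add_sub_cancel_right] at h1
      rw [Finset.sum_range_succ, ih]
      have e : ((N + (M + 1) : ℕ) : ℝ) = M + N + 1 := by push_cast; ring
      have hm : (0 : ℝ) < m + 1 := by positivity
      rw [e]
      push_cast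
      rw [← add_assoc (M : ℝ) N 1, h1, h2]
      field_simp
      ring
  rw [key]
  have hx : (m : ℝ) < M + N := by exact_mod_cast (by omega : m < M + N)
  have h1 := stepProd_pos hx
  have h2 := stepProd_pos (show (m : ℝ) < M + N + 1 by linarith)
  gcongr
  linarith

theorem summable_chebIntegral_truncPow {u : ℝ} (hu : u ∈ Icc (-1 : ℝ) 1) (m : ℕ) :
    Summable fun j : ℤ => chebIntegral (truncPow (m + 1) u) j := by
  have h : Summable fun j : ℕ => chebIntegral (truncPow (m + 1) u) (j : ℤ) := by
    rw [← summable_nat_add_iff (m + 1 + 1)]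
    refine Summable.of_norm_bounded (g := fun i : ℕ => stepProd (m + 1) (i + (m + 1 + 1) : ℕ))
      (summable_of_sum_range_le (fun i => (stepProd_pos ?_).le) (sum_stepProd_le le_rfl))
      fun i => ?_
    · exact_mod_cast (by omega : m + 1 < i + (m + 1 + 1))
    · exact_mod_cast abs_chebIntegral_truncPow_le hu (m + 1)
        (by push_cast; omega : ((m + 1 : ℕ) : ℤ) < (i + (m + 1 + 1) : ℕ))
  exact h.of_nat_of_neg (by simpa only [chebIntegral_neg] using h)

/-- A continuous function with summable Chebyshev coefficients is the sum of its Chebyshev series.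
The series is written over `ℤ`, as the Fourier series of the even function `θ ↦ φ (cos θ)`. -/
theorem hasSum_chebIntegral {φ : ℝ → ℝ} (hφ : Continuous φ)
    (hs : Summable fun j : ℤ => chebIntegral φ j) (τ : ℝ) :
    HasSum (fun j : ℤ => 1 / Real.pi * chebIntegral φ j * Real.cos (j * τ)) (φ (Real.cos τ)) := by
  have : Fact (0 < 2 * Real.pi) := ⟨by positivity⟩
  let F : C(AddCircle (2 * Real.pi), ℂ) :=
    ⟨fun x => (φ (Real.Angle.cos x) : ℂ),
      Complex.continuous_ofReal.comp (hφ.comp Real.Angle.continuous_cos)⟩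
  have hF : ∀ x : ℝ, F (x : AddCircle (2 * Real.pi)) = (φ (Real.cos x) : ℂ) := fun x => rfl
  have hfour : ∀ (j : ℤ) (x : ℝ), fourier j (x : AddCircle (2 * Real.pi)) =
      Complex.exp ((j * x : ℝ) * Complex.I) := by
    intro j x
    rw [fourier_coe_apply]
    congr 1
    have : (Real.pi : ℂ) ≠ 0 := by exact_mod_cast Real.pi_ne_zero
    push_cast
    field_simp
  have hcoeff : ∀ j : ℤ, fourierCoeff F j = ((1 / Real.pi * chebIntegral φ j : ℝ) : ℂ) := by
    intro j
    rw [fourierCoeff_eq_intervalIntegral F j (-Real.pi)]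
    have hcont : Continuous fun x : ℝ => fourier (-j) (x : AddCircle (2 * Real.pi)) •
        F (x : AddCircle (2 * Real.pi)) := by
      simp only [hF, hfour]
      fun_prop
    rw [show -Real.pi + 2 * Real.pi = Real.pi by ring,
      ← intervalIntegral.integral_add_adjacent_intervals (hcont.intervalIntegrable (-Real.pi) 0)
        (hcont.intervalIntegrable 0 Real.pi)]
    have hcont' : Continuous fun x : ℝ => fourier (-j) ((-x : ℝ) : AddCircle (2 * Real.pi)) •
        F ((-x : ℝ) : AddCircle (2 * Real.pi)) := hcont.comp continuous_neg
    have hneg := intervalIntegral.integral_comp_neg (a := 0) (b := Real.pi)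
      (fun x : ℝ => fourier (-j) (x : AddCircle (2 * Real.pi)) •
        F (x : AddCircle (2 * Real.pi)))
    rw [neg_zero] at hneg
    rw [← hneg, ← intervalIntegral.integral_add
      (hcont'.intervalIntegrable _ _) (hcont.intervalIntegrable _ _)]
    have : ∀ x : ℝ, fourier (-j) ((-x : ℝ) : AddCircle (2 * Real.pi)) •
          F ((-x : ℝ) : AddCircle (2 * Real.pi)) +
        fourier (-j) (x : AddCircle (2 * Real.pi)) • F (x : AddCircle (2 * Real.pi)) =
        ((2 * (φ (Real.cos x) * Real.cos (j * x)) : ℝ) : ℂ) := by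
      intro x
      simp only [hF, hfour, Real.cos_neg, smul_eq_mul]
      push_cast
      rw [Complex.cos]
      ring_nf
    simp only [this]
    rw [intervalIntegral.integral_ofReal, intervalIntegral.integral_const_mul]
    simp only [chebIntegral, Complex.real_smul]
    rw [← Complex.ofReal_mul]
    congr 1
    field_simp
  have hsum : Summable (fourierCoeff F) := by
    have : fourierCoeff F = fun j => ((1 / Real.pi * chebIntegral φ j : ℝ) : ℂ) := funext hcoeff
    rw [this]
    exact Complex.hasSum_ofReal.2 (hs.mul_left _).hasSum |>.summable
  have key := Complex.hasSum_re
    (has_pointwise_sum_fourier_series_of_summable hsum (τ : AddCircle (2 * Real.pi)))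
  rw [hF, Complex.ofReal_re] at key
  refine key.congr_fun fun j => ?_
  rw [hcoeff, hfour, smul_eq_mul, Complex.re_ofReal_mul, Complex.exp_ofReal_mul_I_re]

/-- The remainder of a truncated power, when the remainder of `T_i` is bounded by `c` and vanishes
for `|i| ≤ M`: only the tail of the Chebyshev series contributes. -/
theorem abs_chebRemainder_truncPow_le {n d m M : ℕ} {c : ℝ} (hM : m + 1 ≤ M)
    (h0 : ∀ (i : ℤ) (τ : ℝ), |i| ≤ M →
      chebRemainder n d (fun t => (Polynomial.Chebyshev.T ℝ i).eval t) (Real.cos τ) = 0)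
    (hc : ∀ (i : ℤ) (τ : ℝ),
      |chebRemainder n d (fun t => (Polynomial.Chebyshev.T ℝ i).eval t) (Real.cos τ)| ≤ c)
    {u : ℝ} (hu : u ∈ Icc (-1 : ℝ) 1) (τ : ℝ) :
    |chebRemainder n d (truncPow (m + 1) u) (Real.cos τ)| ≤
      c / (Real.pi * (m + 1)) * (stepProd m M + stepProd m (M + 1)) := by
  have hc0 : 0 ≤ c := (abs_nonneg _).trans (hc 0 0)
  set α : ℤ → ℝ := fun i => 1 / Real.pi * chebIntegral (truncPow (m + 1) u) i with hα
  set R : ℤ → ℝ := fun i =>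
    chebRemainder n d (fun t => (Polynomial.Chebyshev.T ℝ i).eval t) (Real.cos τ) with hR
  have hαneg : ∀ i, α (-i) = α i := fun i => by simp only [hα, chebIntegral_neg]
  have hser := hasSum_chebIntegral (continuous_truncPow_succ m u)
    (summable_chebIntegral_truncPow hu m)
  have hsum : HasSum (fun i => α i * R i)
      (chebRemainder n d (truncPow (m + 1) u) (Real.cos τ)) := by
    have := (hser τ).sub (hasSum_sum (s := Finset.Icc 1 n) fun l _ =>
      (hser (chebAngle n l)).mul_right (chebKernel n d l (Real.cos τ)))
    refine this.congr_fun fun i => ?_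
    simp only [hR, chebRemainder, chebPoint_eq_cos, Polynomial.Chebyshev.T_real_cos, hα, mul_sub,
      Finset.mul_sum, mul_assoc]
  have hR0 : ∀ i : ℤ, |i| ≤ M → α i * R i = 0 := fun i hi => by
    simp only [hR, h0 i τ hi, mul_zero]
  -- fold the series at `0` and drop the first `M + 1` terms, which vanish
  have htail := (hasSum_nat_add_iff' (M + 1)).2 hsum.nat_add_neg
  rw [hR0 0 (by simp), add_zero, Finset.sum_eq_zero, sub_zero] at htail
  swap
  · intro i hi
    have hi' : i < M + 1 := Finset.mem_range.1 hi
    rw [hR0 _ (by simp; omega), hR0 _ (by simp; omega), add_zero]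
  have hterm : ∀ i : ℕ, ‖α ((i + (M + 1) : ℕ) : ℤ) * R ((i + (M + 1) : ℕ) : ℤ) +
      α (-((i + (M + 1) : ℕ) : ℤ)) * R (-((i + (M + 1) : ℕ) : ℤ))‖ ≤
      2 * c / Real.pi * stepProd (m + 1) (i + (M + 1) : ℕ) := by
    intro i
    have hb : |α ((i + (M + 1) : ℕ) : ℤ)| ≤ 1 / Real.pi * stepProd (m + 1) (i + (M + 1) : ℕ) := by
      rw [hα, abs_mul, abs_of_pos (by positivity)]
      gcongr
      exact_mod_cast abs_chebIntegral_truncPow_le hu (m + 1)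
        (by push_cast; omega : ((m + 1 : ℕ) : ℤ) < (i + (M + 1) : ℕ))
    rw [hαneg, ← mul_add, Real.norm_eq_abs, abs_mul]
    calc _ ≤ 1 / Real.pi * stepProd (m + 1) (i + (M + 1) : ℕ) * (c + c) :=
          mul_le_mul hb ((abs_add_le _ _).trans (add_le_add (hc _ _) (hc _ _))) (abs_nonneg _)
            ((abs_nonneg _).trans hb)
      _ = _ := by ring
  have hpos : ∀ i : ℕ, 0 ≤ stepProd (m + 1) (i + (M + 1) : ℕ) := fun i =>
    (stepProd_pos (by exact_mod_cast (by omega : m + 1 < i + (M + 1)))).le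
  have hS := summable_of_sum_range_le hpos (sum_stepProd_le hM)
  have hle := tsum_of_norm_bounded (hS.hasSum.mul_left (2 * c / Real.pi)) hterm
  rw [htail.tsum_eq, Real.norm_eq_abs] at hle
  refine hle.trans ?_
  calc _ ≤ 2 * c / Real.pi * ((stepProd m M + stepProd m (M + 1)) / (2 * (m + 1))) := by
        gcongr
        exact Real.tsum_le_of_sum_range_le hpos (sum_stepProd_le hM)
    _ = _ := by
        have := Real.pi_ne_zero
        field_simp

/-! ### Functions whose derivative has a measure as distributional derivative -/

theorem MeasureTheory.LocallyIntegrableOn.integrable_mul_of_tsupport_subset {h w : ℝ → ℝ}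
    {U : Set ℝ} (hh : LocallyIntegrableOn h U) (hw : Continuous w) (hc : HasCompactSupport w)
    (hU : tsupport w ⊆ U) : Integrable fun x => h x * w x := by
  refine (integrableOn_iff_integrable_of_support_subset (s := tsupport w) ?_).1
    ((hh.integrableOn_compact_subset hU hc).mul_continuousOn hw.continuousOn hc)
  exact (Function.support_mul_subset_right _ _).trans (subset_tsupport w)

/-- A smooth function with compact support in `(a,b)` and integral zero is the derivative of a
smooth function with compact support in `(a,b)`. -/
theorem exists_hasCompactSupport_deriv_eq {a b : ℝ} {w : ℝ → ℝ} (hw : ContDiff ℝ ∞ w)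
    (hc : HasCompactSupport w) (hU : tsupport w ⊆ Ioo a b) (h0 : ∫ x, w x = 0) :
    ∃ φ : ℝ → ℝ, ContDiff ℝ ∞ φ ∧ HasCompactSupport φ ∧ tsupport φ ⊆ Ioo a b ∧ deriv φ = w := by
  rcases (tsupport w).eq_empty_or_nonempty with he | hne
  · have : w = 0 := tsupport_eq_empty_iff.1 he
    exact ⟨0, contDiff_const, HasCompactSupport.zero, by simp, by simp [this]⟩
  obtain ⟨α, hα, hαle⟩ := hc.isCompact.exists_isLeast hne
  obtain ⟨β, hβ, hβle⟩ := hc.isCompact.exists_isGreatest hne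
  have hout : ∀ x, x ∉ Icc α β → w x = 0 := fun x hx => by
    by_contra hne
    have hx' : x ∈ tsupport w := subset_tsupport w hne
    exact hx ⟨hαle hx', hβle hx'⟩
  have hint : ∀ x y, IntervalIntegrable w volume x y := fun x y =>
    hw.continuous.intervalIntegrable x y
  have hαβ : α ≤ β := hαle hβ
  have htot : ∫ x in α..β, w x = 0 := by
    rw [intervalIntegral.integral_of_le hαβ, ← integral_Icc_eq_integral_Ioc,
      setIntegral_eq_integral_of_forall_compl_eq_zero hout, h0]
  have hder : ∀ x, HasDerivAt (fun x => ∫ y in α..x, w y) (w x) x := fun x =>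
    (hw.continuous.integral_hasStrictDerivAt α x).hasDerivAt
  have hderiv : deriv (fun x => ∫ y in α..x, w y) = w := funext fun x => (hder x).deriv
  have hsupp : Function.support (fun x => ∫ y in α..x, w y) ⊆ Icc α β := by
    intro x hx
    by_contra hxn
    apply hx
    dsimp only
    rcases lt_or_ge x α with h | h
    · rw [intervalIntegral.integral_symm, neg_eq_zero]
      refine (intervalIntegral.integral_congr_Ioo_of_le (g := fun _ => 0) h.le fun y hy => ?_).trans
        (by simp)
      exact hout y fun hy' => hy'.1.not_gt hy.2
    · have h' : β < x := not_le.1 fun h' => hxn ⟨h, h'⟩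
      rw [← intervalIntegral.integral_add_adjacent_intervals (hint α β) (hint β x), htot, zero_add]
      refine (intervalIntegral.integral_congr_Ioo_of_le (g := fun _ => 0) h'.le
        fun y hy => ?_).trans (by simp)
      exact hout y fun hy' => hy'.2.not_gt hy.1
  refine ⟨fun x => ∫ y in α..x, w y, ?_,
    HasCompactSupport.of_support_subset_isCompact isCompact_Icc hsupp,
    (closure_minimal hsupp isClosed_Icc).trans (Icc_subset_Ioo (hU hα).1 (hU hβ).2), hderiv⟩
  rw [contDiff_infty_iff_deriv, hderiv]
  exact ⟨fun x => (hder x).differentiableAt, hw⟩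

/-- The lemma of du Bois-Reymond: a function with vanishing distributional derivative is almost
everywhere constant. -/
theorem ae_eq_const_of_integral_mul_deriv_eq_zero {a b : ℝ} (hab : a < b) {h : ℝ → ℝ}
    (hh : LocallyIntegrableOn h (Ioo a b))
    (h0 : ∀ φ : ℝ → ℝ, ContDiff ℝ ∞ φ → HasCompactSupport φ → tsupport φ ⊆ Ioo a b →
      ∫ x, h x * deriv φ x = 0) :
    ∃ c, ∀ᵐ x, x ∈ Ioo a b → h x = c := by
  -- a bump function `ψ` with integral `1`; the constant is the mean of `h` with respect to `ψ`
  let B : ContDiffBump ((a + b) / 2) :=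
    ⟨(b - a) / 8, (b - a) / 4, by linarith, by linarith⟩
  set ψ : ℝ → ℝ := B.normed volume with hψ
  have hψd : ContDiff ℝ ∞ ψ := B.contDiff_normed
  have hψc : HasCompactSupport ψ := B.hasCompactSupport_normed
  have hψU : tsupport ψ ⊆ Ioo a b := by
    rw [hψ, B.tsupport_normed_eq, Real.closedBall_eq_Icc]
    refine Icc_subset_Ioo ?_ ?_ <;> simp only [B] <;> linarith
  have hψ1 : ∫ x, ψ x = 1 := B.integral_normed
  have hhψ := hh.integrable_mul_of_tsupport_subset hψd.continuous hψc hψU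
  set c := ∫ x, h x * ψ x with hc
  have hconst : LocallyIntegrableOn (fun _ : ℝ => c) (Ioo a b) :=
    (locallyIntegrable_const c).locallyIntegrableOn _
  refine ⟨c, ?_⟩
  have key := isOpen_Ioo.ae_eq_zero_of_integral_contDiff_smul_eq_zero (hh.sub hconst)
    fun g hg hgc hgU => ?_
  · filter_upwards [key] with x hx hxU
    have := hx hxU
    simp only [Pi.sub_apply] at this
    linarith
  -- `g - (∫ g) ψ` has integral zero, so it is the derivative of a test function
  set I := ∫ x, g x with hI
  have hgi : Integrable g := hg.continuous.integrable_of_hasCompactSupport hgc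
  have hψi : Integrable ψ := hψd.continuous.integrable_of_hasCompactSupport hψc
  have hts : tsupport (fun x => g x - I * ψ x) ⊆ tsupport g ∪ tsupport ψ := by
    refine closure_minimal (fun x hx => ?_) ((isClosed_tsupport g).union (isClosed_tsupport ψ))
    by_contra hn
    rw [mem_union, not_or] at hn
    exact hx (by simp [image_eq_zero_of_notMem_tsupport hn.1,
      image_eq_zero_of_notMem_tsupport hn.2])
  obtain ⟨φ, hφd, hφc, hφU, hφ⟩ := exists_hasCompactSupport_deriv_eq (a := a) (b := b)
    (w := fun x => g x - I * ψ x) (hg.sub (contDiff_const.mul hψd))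
    ((hgc.isCompact.union hψc.isCompact).of_isClosed_subset (isClosed_tsupport _) hts)
    (hts.trans (union_subset hgU hψU))
    (by rw [integral_sub hgi (hψi.const_mul I), integral_const_mul, hψ1]; simp [hI])
  have hhg := hh.integrable_mul_of_tsupport_subset hg.continuous hgc hgU
  have e := h0 φ hφd hφc hφU
  rw [hφ] at e
  have e1 : ∫ x, h x * (g x - I * ψ x) = (∫ x, h x * g x) - I * c := by
    rw [hc, ← integral_const_mul, ← integral_sub hhg (hhψ.const_mul I)]
    exact integral_congr_ae (Filter.Eventually.of_forall fun x => by simp only; ring)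
  have e2 : ∫ x, g x • (h - (fun _ => c : ℝ → ℝ)) x = (∫ x, h x * g x) - c * I := by
    rw [hI, ← integral_const_mul, ← integral_sub hhg (hgi.const_mul c)]
    exact integral_congr_ae (Filter.Eventually.of_forall fun x => by
      simp only [Pi.sub_apply, smul_eq_mul]; ring)
  linarith

/-- The function `x ↦ ∫_(a,b) (x - u)₊ ^ m / m! dν(u)`, the `(m + 1)`-fold primitive of the
restriction of `ν` to `(a,b)`. For `m = 0` it is `x ↦ ν (a,x)` on `(a,b)`. -/
def truncPot (a b : ℝ) (ν : Measure ℝ) (m : ℕ) (x : ℝ) : ℝ :=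
  ∫ u in Ioo a b, truncPow m u x ∂ν

/-- Truncated powers are integrable for the product of a finite measure on `(a,b)` with Lebesgue
measure on a bounded set. -/
theorem integrable_truncPow_prod {a b : ℝ} (ν : Measure ℝ) [IsFiniteMeasure ν] (m : ℕ)
    {s : Set ℝ} (hs : MeasurableSet s) (hsb : s ⊆ Icc a b) :
    Integrable (fun p : ℝ × ℝ => truncPow m p.1 p.2)
      ((ν.restrict (Ioo a b)).prod (volume.restrict s)) := by
  have : IsFiniteMeasure (volume.restrict s) :=
    ⟨by rw [Measure.restrict_apply_univ]
        exact (measure_mono hsb).trans_lt measure_Icc_lt_top⟩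
  refine Integrable.of_bound (measurable_truncPow m).aestronglyMeasurable ((b - a) ^ m) ?_
  rw [Measure.prod_restrict]
  refine (ae_restrict_mem (measurableSet_Ioo.prod hs)).mono fun p hp => ?_
  have h1 := hp.1
  have h2 := hsb hp.2
  rw [Real.norm_of_nonneg (truncPow_nonneg _ _ _)]
  exact truncPow_le (by linarith [h1.1, h1.2]) (by linarith [h1.1, h2.2])

theorem integrableOn_truncPot {a b : ℝ} (ν : Measure ℝ) [IsFiniteMeasure ν] (m : ℕ) :
    IntegrableOn (truncPot a b ν m) (Icc a b) :=
  (integrable_truncPow_prod ν m measurableSet_Icc subset_rfl).integral_prod_right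

theorem integrableOn_truncPow {a b : ℝ} (ν : Measure ℝ) [IsFiniteMeasure ν] (m : ℕ) {x : ℝ}
    (hx : x ≤ b) : IntegrableOn (fun u => truncPow m u x) (Ioo a b) ν := by
  refine Integrable.of_bound ((measurable_truncPow m).comp
    (measurable_id.prodMk measurable_const)).aestronglyMeasurable ((b - a) ^ m) ?_
  refine (ae_restrict_mem measurableSet_Ioo).mono fun u hu => ?_
  simp only [Real.norm_of_nonneg (truncPow_nonneg _ _ _)]
  exact truncPow_le (by linarith [hu.1, hu.2]) (by linarith [hu.1])

theorem integral_truncPow (m : ℕ) {a u x : ℝ} (hu : a ≤ u) (hx : a ≤ x) :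
    ∫ y in a..x, truncPow m u y = truncPow (m + 1) u x := by
  have hi : IntervalIntegrable (truncPow m u) volume a x := by
    refine (intervalIntegrable_const (c := (x - a) ^ m)).mono_fun
      ((measurable_truncPow m).comp (measurable_const.prodMk measurable_id)).aestronglyMeasurable ?_
    refine (ae_restrict_mem measurableSet_uIoc).mono fun y hy => ?_
    rw [uIoc_of_le hx] at hy
    change ‖truncPow m u y‖ ≤ _
    rw [Real.norm_of_nonneg (truncPow_nonneg _ _ _),
      Real.norm_of_nonneg (pow_nonneg (by linarith) _)]
    exact truncPow_le (by linarith) (by linarith [hy.2])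
  rw [integral_eq_of_hasDerivAt_off_countable_of_le _ _ hx (countable_singleton u)
    (continuous_truncPow_succ m u).continuousOn
    (fun y hy => hasDerivAt_truncPow_succ hy.2) hi]
  simp [truncPow, hu.not_gt]

theorem integral_truncPot {a b : ℝ} (ν : Measure ℝ) [IsFiniteMeasure ν] (m : ℕ) {x : ℝ}
    (hx : x ∈ Icc a b) : ∫ y in a..x, truncPot a b ν m y = truncPot a b ν (m + 1) x := by
  rw [intervalIntegral.integral_of_le hx.1]
  simp only [truncPot]
  rw [← integral_integral_swap (f := fun u y => truncPow m u y) (integrable_truncPow_prod ν m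
    measurableSet_Ioc (Ioc_subset_Icc_self.trans (Icc_subset_Icc_right hx.2)))]
  refine setIntegral_congr_fun measurableSet_Ioo fun u hu => ?_
  rw [← intervalIntegral.integral_of_le hx.1, integral_truncPow m hu.1.le hx.1]

/-- The distributional derivative of `x ↦ ν (a,x)` on `(a,b)` is `ν`. -/
theorem integral_truncPot_zero_mul_deriv {a b : ℝ} (ν : Measure ℝ)
    [IsFiniteMeasure ν] {φ : ℝ → ℝ} (hφ : ContDiff ℝ ∞ φ) (hc : HasCompactSupport φ)
    (hU : tsupport φ ⊆ Ioo a b) :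
    ∫ x in Ioo a b, truncPot a b ν 0 x * deriv φ x = -∫ u, φ u ∂ν := by
  have hd : Continuous (deriv φ) := (contDiff_infty_iff_deriv.1 hφ).2.continuous
  have hzero : ∀ u, u ∉ Ioo a b → φ u = 0 := fun u hu =>
    image_eq_zero_of_notMem_tsupport fun h => hu (hU h)
  obtain ⟨C, hC⟩ := hc.deriv.exists_bound_of_continuous hd
  have hint : Integrable (fun p : ℝ × ℝ => truncPow 0 p.1 p.2 * deriv φ p.2)
      ((ν.restrict (Ioo a b)).prod (volume.restrict (Ioo a b))) :=
    (integrable_truncPow_prod ν 0 measurableSet_Ioo Ioo_subset_Icc_self).mul_bdd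
      (c := C) (hd.comp continuous_snd).aestronglyMeasurable
      (Filter.Eventually.of_forall fun p => hC _)
  simp only [truncPot, ← integral_mul_const]
  rw [← integral_integral_swap (f := fun u x => truncPow 0 u x * deriv φ x) hint,
    ← setIntegral_eq_integral_of_forall_compl_eq_zero hzero, ← integral_neg]
  refine setIntegral_congr_fun measurableSet_Ioo fun u hu => ?_
  have hind : ∀ x, truncPow 0 u x * deriv φ x = (Ioi u).indicator (deriv φ) x := fun x => by
    by_cases h : u < x <;> simp [truncPow, h]
  simp only [hind]
  rw [setIntegral_indicator measurableSet_Ioi, inter_comm, Ioi_inter_Ioo, max_eq_left hu.1.le,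
    ← integral_Ioc_eq_integral_Ioo, ← intervalIntegral.integral_of_le hu.2.le,
    intervalIntegral.integral_deriv_eq_sub
      (fun x _ => (contDiff_infty_iff_deriv.1 hφ).1 x) (hd.intervalIntegrable _ _),
    hzero b (by simp), zero_sub]

/-- A function whose distributional derivative is the signed measure `μ` is, up to a constant, the
primitive of `μ`. -/
theorem IsDistribDeriv.exists_ae_eq {a b : ℝ} (hab : a < b) {g : ℝ → ℝ} {μ : SignedMeasure ℝ}
    (h : IsDistribDeriv a b g μ) :
    ∃ c, ∀ᵐ x, x ∈ Ioo a b → g x = c +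
      (truncPot a b μ.toJordanDecomposition.posPart 0 x -
        truncPot a b μ.toJordanDecomposition.negPart 0 x) := by
  set ν₁ := μ.toJordanDecomposition.posPart
  set ν₂ := μ.toJordanDecomposition.negPart
  have hi₁ := (integrableOn_truncPot (a := a) (b := b) ν₁ 0).mono_set Ioo_subset_Icc_self
  have hi₂ := (integrableOn_truncPot (a := a) (b := b) ν₂ 0).mono_set Ioo_subset_Icc_self
  have hl := hi₁.locallyIntegrableOn.sub hi₂.locallyIntegrableOn
  have h0 : ∀ φ : ℝ → ℝ, ContDiff ℝ ∞ φ → HasCompactSupport φ → tsupport φ ⊆ Ioo a b →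
      ∫ x, (g - (truncPot a b ν₁ 0 - truncPot a b ν₂ 0)) x * deriv φ x = 0 := by
    intro φ hφ hcs hU
    have hd : Continuous (deriv φ) := (contDiff_infty_iff_deriv.1 hφ).2.continuous
    have hU' : tsupport (deriv φ) ⊆ Ioo a b := tsupport_deriv_subset.trans hU
    have hzero : ∀ x, x ∉ Ioo a b → deriv φ x = 0 := fun x hx =>
      image_eq_zero_of_notMem_tsupport fun h => hx (hU' h)
    have I {w : ℝ → ℝ} (hw : LocallyIntegrableOn w (Ioo a b)) :
        IntegrableOn (fun x => w x * deriv φ x) (Ioo a b) :=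
      (hw.integrable_mul_of_tsupport_subset hd hcs.deriv hU').integrableOn
    rw [← setIntegral_eq_integral_of_forall_compl_eq_zero (s := Ioo a b)
      fun x hx => by rw [hzero x hx, mul_zero]]
    simp only [Pi.sub_apply, sub_mul]
    have J : IntegrableOn (fun x => truncPot a b ν₁ 0 x * deriv φ x -
        truncPot a b ν₂ 0 x * deriv φ x) (Ioo a b) :=
      (I hi₁.locallyIntegrableOn).sub (I hi₂.locallyIntegrableOn)
    rw [integral_sub (I h.1) J,
      integral_sub (I hi₁.locallyIntegrableOn) (I hi₂.locallyIntegrableOn),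
      h.2 φ hφ hcs hU, integral_truncPot_zero_mul_deriv ν₁ hφ hcs hU,
      integral_truncPot_zero_mul_deriv ν₂ hφ hcs hU]
    ring
  obtain ⟨c, hc⟩ := ae_eq_const_of_integral_mul_deriv_eq_zero hab (h.1.sub hl) h0
  refine ⟨c, hc.mono fun x hx hxU => ?_⟩
  have := hx hxU
  simp only [Pi.sub_apply] at this
  linarith

theorem Polynomial.exists_derivative_eq (p : Polynomial ℝ) :
    ∃ q : Polynomial ℝ, q.derivative = p ∧ q.natDegree ≤ p.natDegree + 1 := by
  refine ⟨∑ i ∈ Finset.range (p.natDegree + 1),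
    Polynomial.monomial (i + 1) (p.coeff i / (i + 1)), ?_, ?_⟩
  · conv_rhs => rw [p.as_sum_range]
    rw [Polynomial.derivative_sum]
    refine Finset.sum_congr rfl fun i _ => ?_
    rw [Polynomial.derivative_monomial]
    have : ((i : ℝ) + 1) ≠ 0 := by positivity
    push_cast
    rw [div_mul_cancel₀ _ this]
  · refine Polynomial.natDegree_sum_le_of_forall_le _ _ fun i hi => ?_
    exact (Polynomial.natDegree_monomial_le _).trans (by simpa using hi)

/-- One integration in the representation by a polynomial and truncated powers. -/
theorem AbsolutelyContinuousOnInterval.eq_polynomial_add_truncPot {a b : ℝ} (hab : a < b)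
    {q : ℝ → ℝ} (hq : AbsolutelyContinuousOnInterval q a b) {ν₁ ν₂ : Measure ℝ}
    [IsFiniteMeasure ν₁] [IsFiniteMeasure ν₂] {m : ℕ} {p : Polynomial ℝ}
    (h : ∀ᵐ x, x ∈ Ioo a b → derivWithin q (Icc a b) x =
      p.eval x + (truncPot a b ν₁ m x - truncPot a b ν₂ m x)) :
    ∃ r : Polynomial ℝ, r.natDegree ≤ p.natDegree + 1 ∧ ∀ x ∈ Icc a b,
      q x = r.eval x + (truncPot a b ν₁ (m + 1) x - truncPot a b ν₂ (m + 1) x) := by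
  obtain ⟨P, hP, hdeg⟩ := Polynomial.exists_derivative_eq p
  refine ⟨P + Polynomial.C (q a - P.eval a), by rwa [Polynomial.natDegree_add_C], fun x hx => ?_⟩
  have hsub : uIcc a x ⊆ uIcc a b := by
    rw [uIcc_of_le hx.1, uIcc_of_le hab.le]; exact Icc_subset_Icc_right hx.2
  have hint := (hq.mono hsub).integral_deriv_eq_sub
  have hi {ν : Measure ℝ} [IsFiniteMeasure ν] :
      IntervalIntegrable (truncPot a b ν m) volume a x := by
    rw [intervalIntegrable_iff_integrableOn_Icc_of_le hx.1]
    exact (integrableOn_truncPot ν m).mono_set (Icc_subset_Icc_right hx.2)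
  have hpi : IntervalIntegrable (fun y => p.eval y) volume a x :=
    p.continuous.intervalIntegrable _ _
  -- `derivWithin` and `deriv` agree in the interior of the interval
  have hcongr : ∫ y in a..x, deriv q y =
      ∫ y in a..x, (p.eval y + (truncPot a b ν₁ m y - truncPot a b ν₂ m y)) := by
    refine intervalIntegral.integral_congr_ae ?_
    filter_upwards [h, compl_mem_ae_iff.2 (measure_singleton b)] with y hy hyb hyx
    rw [uIoc_of_le hx.1] at hyx
    have hyb' : y < b := lt_of_le_of_ne (hyx.2.trans hx.2) hyb
    rw [← hy ⟨hyx.1, hyb'⟩, derivWithin_of_mem_nhds (Icc_mem_nhds hyx.1 hyb')]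
  have hpint : ∫ y in a..x, p.eval y = P.eval x - P.eval a :=
    intervalIntegral.integral_eq_sub_of_hasDerivAt
      (fun y _ => by rw [← hP]; exact P.hasDerivAt y) hpi
  rw [hcongr, intervalIntegral.integral_add hpi (hi.sub hi), intervalIntegral.integral_sub hi hi,
    integral_truncPot ν₁ m hx, integral_truncPot ν₂ m hx, hpint] at hint
  simp only [Polynomial.eval_add, Polynomial.eval_C]
  linarith

/-- The Taylor formula with integral remainder, for a function whose `k`-th derivative has the
signed measure `μ` as distributional derivative. -/
theorem eq_polynomial_add_truncPot_of_isDistribDeriv {a b : ℝ} (hab : a < b) {f : ℝ → ℝ} {k : ℕ}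
    (hk : 1 ≤ k)
    (hAC : ∀ i < k, AbsolutelyContinuousOnInterval (iteratedDerivWithin i f (Icc a b)) a b)
    {μ : SignedMeasure ℝ} (hμ : IsDistribDeriv a b (iteratedDerivWithin k f (Icc a b)) μ) :
    ∃ p : Polynomial ℝ, p.natDegree ≤ k ∧ ∀ x ∈ Icc a b, f x = p.eval x +
      (truncPot a b μ.toJordanDecomposition.posPart k x -
        truncPot a b μ.toJordanDecomposition.negPart k x) := by
  have key : ∀ m < k, ∃ p : Polynomial ℝ, p.natDegree ≤ m ∧ ∀ᵐ x, x ∈ Ioo a b →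
      iteratedDerivWithin (k - m) f (Icc a b) x = p.eval x +
        (truncPot a b μ.toJordanDecomposition.posPart m x -
          truncPot a b μ.toJordanDecomposition.negPart m x) := by
    intro m
    induction m with
    | zero =>
      intro _
      obtain ⟨c, hc⟩ := hμ.exists_ae_eq hab
      exact ⟨Polynomial.C c, by simp, by simpa using hc⟩
    | succ m ih =>
      intro hm
      obtain ⟨p, hp, h⟩ := ih (by omega)
      rw [show k - m = k - (m + 1) + 1 by omega, iteratedDerivWithin_succ] at h
      obtain ⟨r, hr, h'⟩ := (hAC _ (by omega)).eq_polynomial_add_truncPot hab h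
      exact ⟨r, by omega,
        Filter.Eventually.of_forall fun x hx => h' x (Ioo_subset_Icc_self hx)⟩
  -- the last integration gives the identity at every point and not only almost everywhere
  obtain ⟨p, hp, h⟩ := key (k - 1) (by omega)
  rw [show k - (k - 1) = 0 + 1 by omega, iteratedDerivWithin_succ] at h
  obtain ⟨r, hr, h'⟩ := (hAC 0 (by omega)).eq_polynomial_add_truncPot hab h
  rw [show k - 1 + 1 = k by omega, iteratedDerivWithin_zero] at h'
  exact ⟨r, by omega, h'⟩

/-! ### The error bound -/

theorem sub_chebApprox_eq_chebRemainder {a b : ℝ} (hab : a < b) (f : ℝ → ℝ) (d n : ℕ) (x : ℝ) :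
    f x - chebApprox a b f d n x =
      chebRemainder n d (fun t => f (chebMap a b t)) (chebMapInv a b x) := by
  rw [chebApprox_eq_sum_chebKernel, chebRemainder, chebMap_chebMapInv hab]

theorem chebMap_mem_Icc {a b t : ℝ} (hab : a < b) (ht : t ∈ Icc (-1 : ℝ) 1) :
    chebMap a b t ∈ Icc a b := by
  have := ht.1
  have := ht.2
  constructor <;> unfold chebMap <;> nlinarith

theorem chebMapInv_mem_Icc {a b x : ℝ} (hab : a < b) (hx : x ∈ Icc a b) :
    chebMapInv a b x ∈ Icc (-1 : ℝ) 1 := by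
  have hba : 0 < b - a := sub_pos.2 hab
  have h1 : 0 ≤ 2 * (x - a) / (b - a) := div_nonneg (by linarith [hx.1]) hba.le
  have h2 : 2 * (x - a) / (b - a) ≤ 2 := by rw [div_le_iff₀ hba]; linarith [hx.2]
  constructor <;> unfold chebMapInv <;> linarith

theorem truncPow_chebMap {a b : ℝ} (hab : a < b) (m : ℕ) (u t : ℝ) :
    truncPow m u (chebMap a b t) = ((b - a) / 2) ^ m * truncPow m (chebMapInv a b u) t := by
  have hba : 0 < (b - a) / 2 := by linarith
  have h : chebMap a b t - u = (b - a) / 2 * (t - chebMapInv a b u) := by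
    conv_lhs => rw [← chebMap_chebMapInv hab u]
    unfold chebMap
    ring
  have hiff : u < chebMap a b t ↔ chebMapInv a b u < t := by
    rw [← sub_pos, h, mul_pos_iff_of_pos_left hba, sub_pos]
  simp only [truncPow, hiff, h]
  split_ifs
  · rw [mul_pow, mul_div_assoc]
  · simp

/-- The remainder is a finite linear combination of values, so it passes under the integral. -/
theorem abs_chebRemainder_truncPot_le {a b : ℝ} (hab : a < b) {n d k : ℕ} {C : ℝ}
    (hC : ∀ u ∈ Icc (-1 : ℝ) 1, ∀ τ : ℝ, |chebRemainder n d (truncPow k u) (Real.cos τ)| ≤ C)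
    (ν : Measure ℝ) [IsFiniteMeasure ν] (τ : ℝ) :
    |chebRemainder n d (fun t => truncPot a b ν k (chebMap a b t)) (Real.cos τ)| ≤
      ((b - a) / 2) ^ k * C * ν.real (Ioo a b) := by
  have hba : 0 < (b - a) / 2 := by linarith
  have hi : ∀ τ : ℝ, IntegrableOn (fun u => truncPow k u (chebMap a b (Real.cos τ))) (Ioo a b) ν :=
    fun τ => integrableOn_truncPow ν k
      (chebMap_mem_Icc hab ⟨Real.neg_one_le_cos τ, Real.cos_le_one τ⟩).2
  have e : chebRemainder n d (fun t => truncPot a b ν k (chebMap a b t)) (Real.cos τ) =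
      ∫ u in Ioo a b, ((b - a) / 2) ^ k *
        chebRemainder n d (truncPow k (chebMapInv a b u)) (Real.cos τ) ∂ν := by
    have e' : ∀ u, ((b - a) / 2) ^ k *
        chebRemainder n d (truncPow k (chebMapInv a b u)) (Real.cos τ) =
        truncPow k u (chebMap a b (Real.cos τ)) - ∑ l ∈ Finset.Icc 1 n,
          truncPow k u (chebMap a b (chebPoint n l)) * chebKernel n d l (Real.cos τ) := fun u => by
      simp only [chebRemainder, truncPow_chebMap hab, mul_sub, Finset.mul_sum, mul_assoc]
    simp only [e']
    have hi' : ∀ l ∈ Finset.Icc 1 n, IntegrableOn (fun u =>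
        truncPow k u (chebMap a b (chebPoint n l)) * chebKernel n d l (Real.cos τ)) (Ioo a b) ν :=
      fun l _ => (hi (chebAngle n l)).mul_const _
    rw [integral_sub (hi τ) (integrable_finsetSum _ hi'), integral_finsetSum _ hi']
    simp only [integral_mul_const]
    rfl
  rw [e, ← Real.norm_eq_abs]
  refine norm_setIntegral_le_of_norm_le_const (measure_lt_top _ _) fun u hu => ?_
  rw [Real.norm_eq_abs, abs_mul, abs_of_pos (by positivity)]
  gcongr
  exact hC _ (chebMapInv_mem_Icc hab (Ioo_subset_Icc_self hu)) τ

/-- The geometric mean of `x - a` and `b - x` is at most their arithmetic mean. -/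
theorem measure_Ioo_le_lintegral_chebWeight {a b : ℝ} (hab : a < b) (ν : Measure ℝ) :
    ν (Ioo a b) ≤ ENNReal.ofReal ((b - a) / 2) * ∫⁻ x in Ioo a b, chebWeight a b x ∂ν := by
  have hba : 0 < (b - a) / 2 := by linarith
  rw [← lintegral_const_mul' _ _ ENNReal.ofReal_ne_top, ← setLIntegral_one]
  refine setLIntegral_mono' measurableSet_Ioo fun x hx => ?_
  have h1 : 0 < x - a := sub_pos.2 hx.1
  have h2 : 0 < b - x := sub_pos.2 hx.2
  rw [chebWeight, ← ENNReal.ofReal_mul hba.le, ← ENNReal.ofReal_one]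
  refine ENNReal.ofReal_le_ofReal ?_
  rw [mul_one_div, le_div_iff₀ (by positivity), one_mul]
  exact Real.sqrt_le_iff.2 ⟨hba.le, by nlinarith [sq_nonneg (x - a - (b - x))]⟩

/-- The `L¹` norm of the remainder, when the remainders of polynomials of degree at most `k`
vanish and those of truncated powers are bounded by `C`. -/
theorem eLpNorm_sub_chebApprox_le {a b : ℝ} (hab : a < b) {f : ℝ → ℝ} {n d k : ℕ} {C : ℝ}
    (hk : 1 ≤ k)
    (hp : ∀ p : Polynomial ℝ, p.natDegree ≤ k → ∀ τ : ℝ,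
      chebRemainder n d (fun t => p.eval t) (Real.cos τ) = 0)
    (hC : ∀ u ∈ Icc (-1 : ℝ) 1, ∀ τ : ℝ, |chebRemainder n d (truncPow k u) (Real.cos τ)| ≤ C)
    (hAC : ∀ i < k, AbsolutelyContinuousOnInterval (iteratedDerivWithin i f (Icc a b)) a b)
    {μ : SignedMeasure ℝ} (hμ : IsDistribDeriv a b (iteratedDerivWithin k f (Icc a b)) μ) :
    eLpNorm (fun x => f x - chebApprox a b f d n x) 1 (volume.restrict (Icc a b)) ≤
      ENNReal.ofReal (((b - a) / 2) ^ (k + 2) * (2 * C)) *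
        ∫⁻ x in Ioo a b, chebWeight a b x ∂μ.totalVariation := by
  obtain ⟨p, hpdeg, hf⟩ := eq_polynomial_add_truncPot_of_isDistribDeriv hab hk hAC hμ
  set ν₁ := μ.toJordanDecomposition.posPart with hν₁
  set ν₂ := μ.toJordanDecomposition.negPart with hν₂
  have hba : 0 < (b - a) / 2 := by linarith
  have hC0 : 0 ≤ C := (abs_nonneg _).trans (hC 0 (by simp) 0)
  set K := ((b - a) / 2) ^ k * C with hK
  have hK0 : 0 ≤ K := by positivity
  have hpt : ∀ x ∈ Icc a b, |f x - chebApprox a b f d n x| ≤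
      K * (ν₁.real (Ioo a b) + ν₂.real (Ioo a b)) := by
    intro x hx
    have hx' := chebMapInv_mem_Icc hab hx
    rw [sub_chebApprox_eq_chebRemainder hab, ← Real.cos_arccos hx'.1 hx'.2]
    set τ := Real.arccos (chebMapInv a b x)
    have hG : ∀ τ : ℝ, chebMap a b (Real.cos τ) ∈ Icc a b := fun τ =>
      chebMap_mem_Icc hab ⟨Real.neg_one_le_cos τ, Real.cos_le_one τ⟩
    -- the polynomial part in the variable `t`
    set q : Polynomial ℝ := p.comp (Polynomial.C ((b - a) / 2) * Polynomial.X +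
      Polynomial.C (a + (b - a) / 2)) with hq
    have hqe : ∀ t, q.eval t = p.eval (chebMap a b t) := fun t => by
      rw [hq, Polynomial.eval_comp]
      congr 1
      simp [chebMap]
      ring
    have hqd : q.natDegree ≤ k := by
      rw [hq, Polynomial.natDegree_comp, Polynomial.natDegree_linear hba.ne', mul_one]
      exact hpdeg
    have hsplit : chebRemainder n d (fun t => f (chebMap a b t)) (Real.cos τ) =
        chebRemainder n d (fun t => q.eval t) (Real.cos τ) +
        (chebRemainder n d (fun t => truncPot a b ν₁ k (chebMap a b t)) (Real.cos τ) -
          chebRemainder n d (fun t => truncPot a b ν₂ k (chebMap a b t)) (Real.cos τ)) := by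
      simp only [chebRemainder, chebPoint_eq_cos, hqe, hf _ (hG _), add_mul, sub_mul,
        Finset.sum_add_distrib, Finset.sum_sub_distrib]
      ring
    rw [hsplit, hp q hqd, zero_add, mul_add]
    exact (abs_sub _ _).trans (add_le_add (abs_chebRemainder_truncPot_le hab hC ν₁ τ)
      (abs_chebRemainder_truncPot_le hab hC ν₂ τ))
  have hN : ENNReal.ofReal (ν₁.real (Ioo a b) + ν₂.real (Ioo a b)) =
      μ.totalVariation (Ioo a b) := by
    rw [ENNReal.ofReal_add measureReal_nonneg measureReal_nonneg, ofReal_measureReal,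
      ofReal_measureReal]
    rfl
  calc _ = ∫⁻ x in Icc a b, ‖f x - chebApprox a b f d n x‖ₑ := eLpNorm_one_eq_lintegral_enorm
    _ ≤ ∫⁻ _ in Icc a b, ENNReal.ofReal (K * (ν₁.real (Ioo a b) + ν₂.real (Ioo a b))) := by
        refine setLIntegral_mono' measurableSet_Icc fun x hx => ?_
        rw [Real.enorm_eq_ofReal_abs]
        exact ENNReal.ofReal_le_ofReal (hpt x hx)
    _ = ENNReal.ofReal K * μ.totalVariation (Ioo a b) * ENNReal.ofReal (b - a) := by
        rw [setLIntegral_const, Real.volume_Icc, ENNReal.ofReal_mul hK0, hN]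
    _ ≤ ENNReal.ofReal K * (ENNReal.ofReal ((b - a) / 2) *
          ∫⁻ x in Ioo a b, chebWeight a b x ∂μ.totalVariation) * ENNReal.ofReal (b - a) := by
        gcongr
        exact measure_Ioo_le_lintegral_chebWeight hab _
    _ = _ := by
        have : ((b - a) / 2) ^ (k + 2) * (2 * C) = K * ((b - a) / 2) * (b - a) := by
          rw [hK]; ring
        rw [this, ENNReal.ofReal_mul (mul_nonneg hK0 hba.le), ENNReal.ofReal_mul hK0]
        ring

/-- Both are reciprocals of a product of factors in arithmetic progression with difference `2`; the
hypotheses say that the numbers of factors and the first factors agree. -/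
theorem recipProd_eq_stepProd {s m : ℕ} {α β : ℤ} {η x : ℝ} (hm : (m : ℤ) = 2 * s - α)
    (hx : x - m = η - 2 * s + β) : recipProd s α β η = stepProd m x := by
  rw [recipProd, stepProd, one_div]
  congr 1
  symm
  refine Finset.prod_nbij' (fun i : ℕ => (i : ℤ) - s) (fun i => (i + s).toNat) ?_ ?_ ?_ ?_ ?_
  · intro i hi
    have := Finset.mem_range.1 hi
    rw [Finset.mem_Icc]; omega
  · intro i hi
    have := Finset.mem_Icc.1 hi
    rw [Finset.mem_range]; omega
  · intro i hi; simp
  · intro i hi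
    have := Finset.mem_Icc.1 hi
    omega
  · intro i hi
    push_cast
    linarith

theorem errorBound_of_lt {a b V : ℝ} {m n d : ℕ} (hdn : d < n) :
    errorBound a b V (m + 1) n d = ((b - a) / 2) ^ (m + 1 + 2) *
      (2 * (2 / (Real.pi * (m + 1)) * (stepProd m d + stepProd m (d + 1)))) * V := by
  have hη : (n : ℝ) - ((n - d : ℕ) : ℝ) = d := by
    rw [Nat.cast_sub hdn.le]; ring
  simp only [errorBound, if_pos hdn, hη]
  have hm : (m : ℝ) + 1 ≠ 0 := by positivity
  have hpi := Real.pi_ne_zero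
  split_ifs with h
  · obtain ⟨s, hs⟩ := h.two_dvd
    have hs' : (m : ℝ) = 2 * s - 1 := by rw [eq_sub_iff_add_eq]; exact_mod_cast hs
    have : (m + 1) / 2 = s := by omega
    rw [this, recipProd_eq_stepProd (m := m) (x := d) (by omega) (by push_cast; linarith),
      recipProd_eq_stepProd (m := m) (x := d + 1) (by omega) (by push_cast; linarith)]
    push_cast
    field_simp
    ring
  · have hs : m = 2 * ((m + 1) / 2) := by
      rw [Nat.not_even_iff_odd] at h
      obtain ⟨r, hr⟩ := h
      omega
    set s := (m + 1) / 2
    have hs' : (m : ℝ) = 2 * s := by exact_mod_cast hs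
    rw [recipProd_eq_stepProd (m := m) (x := d) (by omega) (by push_cast; linarith),
      recipProd_eq_stepProd (m := m) (x := d + 1) (by omega) (by push_cast; linarith)]
    push_cast
    field_simp
    ring

theorem errorBound_of_le {a b V : ℝ} {m n d : ℕ} (hnd : n ≤ d) :
    errorBound a b V (m + 1) n d = ((b - a) / 2) ^ (m + 1 + 2) *
      (2 * (3 / (Real.pi * (m + 1)) * (stepProd m (2 * n - d - 1) + stepProd m (2 * n - d)))) *
        V := by
  have hη : (n : ℝ) - ((d - n : ℕ) : ℝ) = 2 * n - d := by
    rw [Nat.cast_sub hnd]; ring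
  simp only [errorBound, if_neg hnd.not_gt, hη]
  have hm : (m : ℝ) + 1 ≠ 0 := by positivity
  have hpi := Real.pi_ne_zero
  split_ifs with h
  · obtain ⟨s, hs⟩ := h.two_dvd
    have hs' : (m : ℝ) = 2 * s - 1 := by rw [eq_sub_iff_add_eq]; exact_mod_cast hs
    have : (m + 1) / 2 = s := by omega
    rw [this, recipProd_eq_stepProd (m := m) (x := 2 * n - d - 1) (by omega)
        (by push_cast; linarith),
      recipProd_eq_stepProd (m := m) (x := 2 * n - d) (by omega) (by push_cast; linarith)]
    push_cast
    field_simp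
    ring
  · have hs : m = 2 * ((m + 1) / 2) := by
      rw [Nat.not_even_iff_odd] at h
      obtain ⟨r, hr⟩ := h
      omega
    set s := (m + 1) / 2
    have hs' : (m : ℝ) = 2 * s := by exact_mod_cast hs
    rw [recipProd_eq_stepProd (m := m) (x := 2 * n - d - 1) (by omega) (by push_cast; linarith),
      recipProd_eq_stepProd (m := m) (x := 2 * n - d) (by omega) (by push_cast; linarith)]
    push_cast
    field_simp
    ring

/-- The error bound in terms of the largest degree `M` that the approximation reproduces and the
largest number `r` of multiples of `2 n` among `2 d + 1` consecutive integers. -/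
theorem eLpNorm_sub_chebApprox_le_chebNorm {a b : ℝ} (hab : a < b) {f : ℝ → ℝ} {n d m M r : ℕ}
    (hM : m + 1 ≤ M) (hMd : M ≤ d) (hMn : M + d < 2 * n) (hr : 2 * d + 1 ≤ r * (2 * n))
    (hAC : ∀ i < m + 1, AbsolutelyContinuousOnInterval (iteratedDerivWithin i f (Icc a b)) a b) :
    eLpNorm (fun x => f x - chebApprox a b f d n x) 1 (volume.restrict (Icc a b)) ≤
      ENNReal.ofReal (((b - a) / 2) ^ (m + 1 + 2) *
        (2 * ((r + 1) / (Real.pi * (m + 1)) * (stepProd m M + stepProd m (M + 1))))) *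
        chebNorm a b (iteratedDerivWithin (m + 1) f (Icc a b)) := by
  have hn : n ≠ 0 := by omega
  have hba : 0 < (b - a) / 2 := by linarith
  have hmM : (m : ℝ) < M := by exact_mod_cast (by omega : m < M)
  have h1 := stepProd_pos hmM
  have h2 := stepProd_pos (show (m : ℝ) < M + 1 by linarith)
  have hpos : 0 < ((b - a) / 2) ^ (m + 1 + 2) *
      (2 * ((r + 1) / (Real.pi * (m + 1)) * (stepProd m M + stepProd m (M + 1)))) := by
    positivity
  have hpos' := (ENNReal.ofReal_pos.2 hpos).ne'
  rw [chebNorm, ENNReal.mul_iInf_of_ne hpos' ENNReal.ofReal_ne_top]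
  refine le_iInf fun μ => ?_
  rw [ENNReal.mul_iInf_of_ne hpos' ENNReal.ofReal_ne_top]
  refine le_iInf fun hμ => ?_
  refine eLpNorm_sub_chebApprox_le hab (by omega) (fun p hp τ =>
    chebRemainder_polynomial_eq_zero hn (by omega : m + 1 ≤ d) (by omega) hp τ)
    (fun u hu τ => abs_chebRemainder_truncPow_le hM (fun i τ hi =>
      chebRemainder_T_eq_zero hn (by omega) (by omega) τ)
      (fun i τ => abs_chebRemainder_T_le hr i τ) hu τ) hAC hμ

end

theorem mainTheorem2 (a b : ℝ) (hab : a < b) (f : ℝ → ℝ) (k n d : ℕ)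
    (hk : 1 ≤ k) (hkn : k + 1 ≤ n) (hkd : k ≤ d) (hdn : d + k + 1 ≤ 2 * n)
    (hAC : ∀ i < k, AbsolutelyContinuousOnInterval (iteratedDerivWithin i f (Icc a b)) a b)
    (hV : chebNorm a b (iteratedDerivWithin k f (Icc a b)) < ⊤) :
    eLpNorm (fun x => f x - chebApprox a b f d n x) 1 (volume.restrict (Icc a b)) ≤
      ENNReal.ofReal
        (errorBound a b (chebNorm a b (iteratedDerivWithin k f (Icc a b))).toReal k n d) := by
  obtain ⟨m, rfl⟩ : ∃ m, k = m + 1 := ⟨k - 1, by omega⟩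
  rcases lt_or_ge d n with h | h
  · rw [errorBound_of_lt h, ENNReal.ofReal_mul' ENNReal.toReal_nonneg,
      ENNReal.ofReal_toReal hV.ne]
    have := eLpNorm_sub_chebApprox_le_chebNorm hab (n := n) (d := d) (M := d) (r := 1) hkd
      le_rfl (by omega) (by omega) hAC
    norm_num at this ⊢
    exact this
  · rw [errorBound_of_le h, ENNReal.ofReal_mul' ENNReal.toReal_nonneg,
      ENNReal.ofReal_toReal hV.ne]
    have := eLpNorm_sub_chebApprox_le_chebNorm hab (n := n) (d := d) (M := 2 * n - d - 1) (r := 2)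
      (by omega) (by omega) (by omega) (by omega) hAC
    have e : ((2 * n - d - 1 : ℕ) : ℝ) = 2 * n - d - 1 := by
      rw [Nat.cast_sub (by omega), Nat.cast_sub (by omega)]
      push_cast
      ring
    rw [e, sub_add_cancel] at this
    norm_num at this ⊢
    exact this
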